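/- Let $n,t\ge 1$ be integers, and write $M_k=M_k(\mathbb C)$ and $i_k$ for the identity map of $M_k$. A linear map $\Phi:M_n\to M_N$ is called $t$-positive if $i_t\otimes\Phi$ maps positive semi-definite matrices to positive semi-definite matrices, and unitarily equivariant if for every unitary $U\in M_n$ there is a unitary $V=V(U)\in M_N$ such that $\Phi(UXU^*)=V\,\Phi(X)\,V^*$ for all $X\in M_n$. For $m\ge 1$ let $$\mathcal S_m(\Phi)=\{\rho \text{ a density matrix on } \mathbb C^m\otimes\mathbb C^n \;:\; (i_m\otimes\Phi)(\rho)\ge 0\}.$$ Let $\operatorname{SN}_t(m,n)$ be the set of density matrices on $\mathbb C^m\otimes\mathbb C^n$ with Schmidt number at most $t$. Here the Schmidt rank $\operatorname{SR}(\psi)$ of a unit vector $\psi$ is the number of terms in a Schmidt decomposition $\psi=\sum_{i=1}^r\sqrt{\lambda_i}\,u_i\otimes v_i$ ($\lambda_i>0$, $(u_i)$ and $(v_i)$ orthonormal), and the Schmidt number of $\rho$ is the minimum of $\max_j\operatorname{SR}(\psi_j)$ over all decompositions $\rho=\sum_j p_j|\psi_j\rangle\langle\psi_j|$ of $\rho$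 as a finite convex combination of pure states. Then there exist integers $N_a\ge 2$ and unitarily equivariant $t$-positive linear maps $\Phi_a:M_n\to M_{N_a}$ ($a\ge 1$), independent of $m$, such that for every $m\ge 1$ the sets $\mathcal S_m(\Phi_a)$ decrease to $\operatorname{SN}_t(m,n)$, that is, $$\mathcal S_m(\Phi_{a+1})\subseteq \mathcal S_m(\Phi_a)\ \text{ for all } a\ge 1,\qquad \bigcap_{a\ge 1}\mathcal S_m(\Phi_a)=\operatorname{SN}_t(m,n).$$ -/

import Mathlib

open scoped Matrix Kronecker ComplexOrder

/-- The algebra `M_n(ℂ)` of complex `n × n` matrices. -/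
abbrev CMat (n : ℕ) : Type := Matrix (Fin n) (Fin n) ℂ

/-- The algebra `M_k(ℂ) ⊗ M_n(ℂ)`, as matrices on `ℂ^k ⊗ ℂ^n`, the product basis of `ℂ^k ⊗ ℂ^n`
being indexed by `Fin k × Fin n`. -/
abbrev CMat₂ (k n : ℕ) : Type := Matrix (Fin k × Fin n) (Fin k × Fin n) ℂ

/-- The map `i_k ⊗ Φ : M_k(ℂ) ⊗ M_n(ℂ) → M_k(ℂ) ⊗ M_N(ℂ)`: apply `Φ` to each of the `k × k` blocks,
which are `n × n` matrices. -/
def ampliation (k : ℕ) {n N : ℕ} (Φ : CMat n →ₗ[ℂ] CMat N) : CMat₂ k n →ₗ[ℂ] CMat₂ k N where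
  toFun X := Matrix.of fun a b =>
    Φ (Matrix.of fun r s => X (a.1, r) (b.1, s)) a.2 b.2
  map_add' X Y := by
    ext a b
    exact congrFun (congrFun (map_add Φ (Matrix.of fun r s => X (a.1, r) (b.1, s))
      (Matrix.of fun r s => Y (a.1, r) (b.1, s))) a.2) b.2
  map_smul' c X := by
    ext a b
    exact congrFun (congrFun (map_smul Φ c (Matrix.of fun r s => X (a.1, r) (b.1, s))) a.2) b.2

/-- `i_k ⊗ Φ` is the linear map which sends `A ⊗ B` to `A ⊗ Φ(B)`. -/
theorem ampliation_kronecker (k : ℕ) {n N : ℕ} (Φ : CMat n →ₗ[ℂ] CMat N) (A : CMat k)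
    (B : CMat n) : ampliation k Φ (A ⊗ₖ B) = A ⊗ₖ Φ B := by
  ext a b
  exact congrFun (congrFun (map_smul Φ (A a.1 b.1) B) a.2) b.2

/-- `Φ` is `t`-positive: `i_t ⊗ Φ` maps positive semi-definite matrices to positive semi-definite
matrices. -/
def IsTPositive (t : ℕ) {n N : ℕ} (Φ : CMat n →ₗ[ℂ] CMat N) : Prop :=
  ∀ X : CMat₂ t n, X.PosSemidef → (ampliation t Φ X).PosSemidef

/-- `Φ` is unitarily equivariant: for every unitary `U` there is a unitary `V = V(U)` such that
`Φ(U X U*) = V Φ(X) V*` for all `X`. -/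
def IsUnitarilyEquivariant {n N : ℕ} (Φ : CMat n →ₗ[ℂ] CMat N) : Prop :=
  ∀ U ∈ Matrix.unitaryGroup (Fin n) ℂ, ∃ V ∈ Matrix.unitaryGroup (Fin N) ℂ,
    ∀ X : CMat n, Φ (U * X * Uᴴ) = V * Φ X * Vᴴ

/-- The set `S(m × n)` of density matrices on `ℂ^m ⊗ ℂ^n`. -/
def densityMatrices (m n : ℕ) : Set (CMat₂ m n) :=
  {ρ | ρ.PosSemidef ∧ ρ.trace = 1}

/-- The set `S_m(Φ)` of density matrices `ρ` on `ℂ^m ⊗ ℂ^n` such that `(i_m ⊗ Φ)(ρ) ≥ 0`. -/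
def undetectedStates (m : ℕ) {n N : ℕ} (Φ : CMat n →ₗ[ℂ] CMat N) : Set (CMat₂ m n) :=
  {ρ | ρ ∈ densityMatrices m n ∧ (ampliation m Φ ρ).PosSemidef}

/-- `ψ ∈ ℂ^m ⊗ ℂ^n` has a Schmidt decomposition `ψ = ∑ i, √(c i) • u i ⊗ v i` with `r` terms, all
the `c i` being positive and the families `u`, `v` being orthonormal. (If `‖ψ‖ = 1` then
`∑ i, c i = 1` automatically.) -/
def HasSchmidtDecomposition {m n : ℕ} (ψ : EuclideanSpace ℂ (Fin m × Fin n)) (r : ℕ) : Prop :=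
  ∃ (c : Fin r → ℝ) (u : Fin r → EuclideanSpace ℂ (Fin m))
    (v : Fin r → EuclideanSpace ℂ (Fin n)),
    (∀ i, 0 < c i) ∧ Orthonormal ℂ u ∧ Orthonormal ℂ v ∧
      ∀ p q, ψ (p, q) = ∑ i, (Real.sqrt (c i) : ℂ) * (u i p * v i q)

/-- The Schmidt rank `SR(ψ)`: the number of terms of a Schmidt decomposition of `ψ`. This number
does not depend on the decomposition, so that the infimum is over a one-element set. -/
noncomputable def schmidtRank {m n : ℕ} (ψ : EuclideanSpace ℂ (Fin m × Fin n)) : ℕ∞ :=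
  ⨅ (r : ℕ) (_ : HasSchmidtDecomposition ψ r), (r : ℕ∞)

/-- `ρ = ∑ j, w j • |ψ j⟩⟨ψ j|` is a decomposition of `ρ` as a convex combination of pure states. -/
def IsPureDecomposition {m n l : ℕ} (ρ : CMat₂ m n) (w : Fin l → ℝ)
    (ψ : Fin l → EuclideanSpace ℂ (Fin m × Fin n)) : Prop :=
  (∀ j, 0 ≤ w j) ∧ ∑ j, w j = 1 ∧ (∀ j, ‖ψ j‖ = 1) ∧
    ρ = ∑ j, (w j : ℂ) • Matrix.vecMulVec (ψ j).ofLp (star (ψ j).ofLp)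

/-- The Schmidt number `SN(ρ)`: the minimum, over all decompositions of `ρ` as a convex combination
of pure states, of the largest Schmidt rank in the decomposition. -/
noncomputable def schmidtNumber {m n : ℕ} (ρ : CMat₂ m n) : ℕ∞ :=
  ⨅ (l : ℕ) (w : Fin l → ℝ) (ψ : Fin l → EuclideanSpace ℂ (Fin m × Fin n))
    (_ : IsPureDecomposition ρ w ψ), ⨆ j, schmidtRank (ψ j)

/-- The set `SN_t(m, n)` of density matrices on `ℂ^m ⊗ ℂ^n` with Schmidt number at most `t`. -/
def schmidtNumberLE (t m n : ℕ) : Set (CMat₂ m n) :=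
  {ρ | ρ ∈ densityMatrices m n ∧ schmidtNumber ρ ≤ (t : ℕ∞)}

/-! A `t`-positive map cannot detect a pure state of Schmidt rank at most `t`, hence no state in the
convex hull of these (`schmidtNumberLE_subset_undetectedStates`). For the converse, this hull is
compact, so Hahn-Banach separates any other state `ρ` from it. The functional gives a matrix `W`
that is nonnegative on vectors of tensor rank at most `t` and negative at `ρ`
(`exists_isRankPositive_pairing_neg`). Read as a linear map `Ψ`, such a `W` is `t`-positive and
detects `ρ`.

In general `Ψ` is not equivariant, and averaging its unitary conjugates alone could wash the
detection out. Instead, the Haar average is taken of `X ↦ |w_A⟩⟨w_A| ⊗ Ψ(A* X A)`, where `w_A = (1 ⊕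
vec A)^{⊗k}` records the rotation `A`. Translating `A` by `U` acts on `w_A` by a unitary, which
gives equivariance. Testing against `w_1 ⊗ y` weights the contribution of `A` by `|1 + tr A|^{2k}`.
As `k → ∞` this weight concentrates at `A = 1`, so what `Ψ` detects is detected for some `k`
(`dotProduct_blockMap_nonneg_of_twirl`).

By separability, countably many witnesses suffice for each `m`, hence countably many equivariant
maps for all `m` and `k` together. Direct sums of initial segments of this sequence give the
decreasing family. -/

variable {n : ℕ} {τ σ κ ι : Type*}

/-- A complex matrix with nonnegative quadratic form is positive semidefinite. -/
theorem Matrix.posSemidef_of_forall_nonneg {ι : Type*} [Fintype ι] {M : Matrix ι ι ℂ}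
    (h : ∀ x : ι → ℂ, 0 ≤ star x ⬝ᵥ (M *ᵥ x)) : M.PosSemidef := by
  classical
  refine .of_dotProduct_mulVec_nonneg ?_ h
  rw [← Matrix.isSymmetric_toEuclideanLin_iff, LinearMap.isSymmetric_iff_inner_map_self_real]
  intro v
  have := h v.ofLp
  rw [Complex.nonneg_iff] at this
  have e : inner ℂ (Matrix.toEuclideanLin M v) v = star (star v.ofLp ⬝ᵥ (M *ᵥ v.ofLp)) := by
    rw [EuclideanSpace.inner_eq_star_dotProduct, Matrix.star_dotProduct, star_star]
    simp [dotProduct_comm]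
  rw [e]
  apply Complex.ext <;> simp [← this.2]


/-! ### Ampliations, `t`-positivity and tensor rank -/

/-- The map `id ⊗ Φ`, for index types which need not be of the form `Fin k`. -/
def blockMap (Φ : CMat n →ₗ[ℂ] Matrix κ κ ℂ) (X : Matrix (τ × Fin n) (τ × Fin n) ℂ) :
    Matrix (τ × κ) (τ × κ) ℂ :=
  Matrix.of fun a b => Φ (X.submatrix (Prod.mk a.1) (Prod.mk b.1)) a.2 b.2

theorem ampliation_eq_blockMap (k : ℕ) {N : ℕ} (Φ : CMat n →ₗ[ℂ] CMat N) (X : CMat₂ k n) :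
    ampliation k Φ X = blockMap Φ X := rfl

theorem blockMap_sum (Φ : CMat n →ₗ[ℂ] Matrix κ κ ℂ) {s : Finset ι}
    (X : ι → Matrix (τ × Fin n) (τ × Fin n) ℂ) :
    blockMap Φ (∑ i ∈ s, X i) = ∑ i ∈ s, blockMap Φ (X i) := by
  ext a b
  have : (∑ i ∈ s, X i).submatrix (Prod.mk a.1) (Prod.mk b.1)
      = ∑ i ∈ s, (X i).submatrix (Prod.mk a.1) (Prod.mk b.1) := by
    ext; simp [Matrix.sum_apply]
  simp [blockMap, this, Matrix.sum_apply]

theorem blockMap_smul (Φ : CMat n →ₗ[ℂ] Matrix κ κ ℂ) (c : ℂ)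
    (X : Matrix (τ × Fin n) (τ × Fin n) ℂ) :
    blockMap Φ (c • X) = c • blockMap Φ X := by
  ext a b
  have : (c • X).submatrix (Prod.mk a.1) (Prod.mk b.1)
      = c • X.submatrix (Prod.mk a.1) (Prod.mk b.1) := rfl
  simp [blockMap, this]

theorem submatrix_kronecker_one_conj [Fintype τ] [Fintype κ] [DecidableEq κ] (L : Matrix σ τ ℂ)
    (X : Matrix (τ × κ) (τ × κ) ℂ) (a b : σ) :
    ((L ⊗ₖ (1 : Matrix κ κ ℂ)) * X * (L ⊗ₖ (1 : Matrix κ κ ℂ))ᴴ).submatrix (Prod.mk a) (Prod.mk b)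
      = ∑ i, ∑ j, (L a i * star (L b j)) • X.submatrix (Prod.mk i) (Prod.mk j) := by
  ext p q
  simp only [Matrix.submatrix_apply, Matrix.mul_apply, Matrix.conjTranspose_apply,
    Matrix.kroneckerMap_apply, Fintype.sum_prod_type, Matrix.one_apply, Matrix.sum_apply,
    Matrix.smul_apply, smul_eq_mul, mul_ite, mul_one, mul_zero, ite_mul, zero_mul,
    apply_ite (star : ℂ → ℂ), star_zero, Finset.sum_ite_eq, Finset.mem_univ, if_true,
    Finset.sum_mul]
  rw [Finset.sum_comm]
  exact Finset.sum_congr rfl fun i _ => Finset.sum_congr rfl fun j _ => by ring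

theorem blockMap_kronecker_one_conj [Fintype τ] [Fintype κ] [DecidableEq κ]
    (Φ : CMat n →ₗ[ℂ] Matrix κ κ ℂ) (L : Matrix σ τ ℂ) (X : Matrix (τ × Fin n) (τ × Fin n) ℂ) :
    blockMap Φ ((L ⊗ₖ (1 : CMat n)) * X * (L ⊗ₖ (1 : CMat n))ᴴ)
      = (L ⊗ₖ (1 : Matrix κ κ ℂ)) * blockMap Φ X * (L ⊗ₖ (1 : Matrix κ κ ℂ))ᴴ := by
  ext ⟨a, p⟩ ⟨b, q⟩
  have h := congrFun (congrFun (submatrix_kronecker_one_conj L (blockMap Φ X) a b) p) q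
  rw [Matrix.submatrix_apply] at h
  rw [h]
  simp only [blockMap, Matrix.of_apply, submatrix_kronecker_one_conj, map_sum, map_smul,
    Matrix.sum_apply, Matrix.smul_apply, Matrix.submatrix_apply]

/-- `t`-positivity for maps into matrices with an arbitrary index type. -/
def IsBlockPositive (t : ℕ) (Φ : CMat n →ₗ[ℂ] Matrix κ κ ℂ) : Prop :=
  ∀ X : CMat₂ t n, X.PosSemidef → (blockMap Φ X).PosSemidef

/-- `ψ` is a sum of at most `t` product vectors. -/
def TensorRankLE (t : ℕ) (ψ : τ × σ → ℂ) : Prop :=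
  ∃ (a : Fin t → τ → ℂ) (b : Fin t → σ → ℂ), ∀ p q, ψ (p, q) = ∑ i, a i p * b i q

/-- A sum of `t` product vectors is `(L ⊗ 1) ξ` with `ξ` in `ℂ^t ⊗ ℂ^n`, and conjugation by `L ⊗ 1`
commutes with `id ⊗ Φ`. So positivity at level `t` carries over to any first factor. -/
theorem IsBlockPositive.blockMap_vecMulVec [Fintype τ] [Fintype κ] {t : ℕ}
    {Φ : CMat n →ₗ[ℂ] Matrix κ κ ℂ} (h : IsBlockPositive t Φ) {ψ : τ × Fin n → ℂ}
    (hψ : TensorRankLE t ψ) : (blockMap Φ (Matrix.vecMulVec ψ (star ψ))).PosSemidef := by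
  classical
  obtain ⟨a, b, hab⟩ := hψ
  let L : Matrix τ (Fin t) ℂ := Matrix.of fun p i => a i p
  let ξ : Fin t × Fin n → ℂ := fun x => b x.1 x.2
  have e : (L ⊗ₖ (1 : CMat n)) *ᵥ ξ = ψ := by
    ext ⟨p, q⟩
    simp [Matrix.mulVec, dotProduct, Fintype.sum_prod_type, L, ξ, Matrix.one_apply, hab]
  have e2 : Matrix.vecMulVec ψ (star ψ)
      = (L ⊗ₖ (1 : CMat n)) * Matrix.vecMulVec ξ (star ξ) * (L ⊗ₖ (1 : CMat n))ᴴ := by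
    rw [Matrix.mul_vecMulVec, Matrix.vecMulVec_mul, e, ← Matrix.star_mulVec, e]
  rw [e2, blockMap_kronecker_one_conj]
  exact (h _ (Matrix.posSemidef_vecMulVec_self_star ξ)).mul_mul_conjTranspose_same _

theorem isBlockPositive_of_vecMulVec [Fintype κ] {t : ℕ} {Φ : CMat n →ₗ[ℂ] Matrix κ κ ℂ}
    (h : ∀ ξ : Fin t × Fin n → ℂ, (blockMap Φ (Matrix.vecMulVec ξ (star ξ))).PosSemidef) :
    IsBlockPositive t Φ := by
  intro X hX
  obtain ⟨k, v, rfl⟩ := Matrix.posSemidef_iff_eq_sum_vecMulVec.mp hX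
  rw [blockMap_sum]
  exact Matrix.posSemidef_sum _ fun i _ => h _

/-! ### Witnesses as linear maps -/

/-- The pairing `∑ W a b X a b` of two matrices. -/
def pairing [Fintype ι] (W X : Matrix ι ι ℂ) : ℂ := ∑ a, ∑ b, W a b * X a b

/-- The linear map associated with a matrix `W` on the tensor product. -/
def mapOfMatrix (W : Matrix (τ × Fin n) (τ × Fin n) ℂ) : CMat n →ₗ[ℂ] Matrix τ τ ℂ where
  toFun X := Matrix.of fun p q => ∑ r, ∑ s, W (p, r) (q, s) * X r s
  map_add' X Y := by ext; simp [mul_add, Finset.sum_add_distrib]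
  map_smul' c X := by ext; simp [Finset.mul_sum, mul_left_comm]

/-- `W` is nonnegative on all vectors of tensor rank at most `t`. -/
def IsRankPositive [Fintype τ] (t : ℕ) (W : Matrix (τ × Fin n) (τ × Fin n) ℂ) : Prop :=
  ∀ ψ : τ × Fin n → ℂ, TensorRankLE t ψ → 0 ≤ pairing W (Matrix.vecMulVec ψ (star ψ))

/-- On `|ξ⟩⟨ξ|`, the quadratic form at `y` is the pairing of `W` with the projector onto the
contraction of `ξ` with the conjugate of `y` over `Fin t`. That contraction is visibly a sum of `t`
product vectors. -/
theorem IsRankPositive.isBlockPositive [Fintype τ] {t : ℕ}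
    {W : Matrix (τ × Fin n) (τ × Fin n) ℂ} (h : IsRankPositive t W) :
    IsBlockPositive t (mapOfMatrix W) := by
  refine isBlockPositive_of_vecMulVec fun ξ => Matrix.posSemidef_of_forall_nonneg fun y => ?_
  have := h (fun x => ∑ i, star (y (i, x.1)) * ξ (i, x.2))
    ⟨fun i p => star (y (i, p)), fun i r => ξ (i, r), fun _ _ => rfl⟩
  convert this using 1
  simp only [pairing, Matrix.vecMulVec_apply, dotProduct, Matrix.mulVec, blockMap, mapOfMatrix,
    Pi.star_apply, Matrix.of_apply, LinearMap.coe_mk, AddHom.coe_mk, Matrix.submatrix_apply,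
    Fintype.sum_prod_type, star_sum, star_mul', star_star, Finset.sum_mul, Finset.mul_sum]
  have key : ∀ f : Fin t → τ → Fin t → τ → Fin n → Fin n → ℂ,
      ∑ i, ∑ p, ∑ j, ∑ q, ∑ r, ∑ s, f i p j q r s = ∑ p, ∑ r, ∑ q, ∑ s, ∑ i, ∑ j, f i p j q r s := by
    intro f
    simp only [← Fintype.sum_prod_type']
    refine Fintype.sum_equiv ⟨fun x => (x.2.1, x.2.2.2.2.1, x.2.2.2.1, x.2.2.2.2.2, x.1, x.2.2.1),
      fun x => (x.2.2.2.2.1, x.1, x.2.2.2.2.2, x.2.2.1, x.2.1, x.2.2.2.1), fun _ => rfl,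
      fun _ => rfl⟩ _ _ fun _ => rfl
  rw [key]
  refine Finset.sum_congr rfl fun _ _ => Finset.sum_congr rfl fun _ _ => Finset.sum_congr rfl
      fun _ _ => Finset.sum_congr rfl fun _ _ => ?_
  rw [Finset.sum_comm]
  exact Finset.sum_congr rfl fun _ _ => Finset.sum_congr rfl fun _ _ => by ring

/-- The unnormalised maximally entangled vector recovers the witness value, so a negative pairing
makes the associated map detect `X`. -/
theorem dotProduct_blockMap_mapOfMatrix [Fintype τ] [DecidableEq τ]
    (W X : Matrix (τ × Fin n) (τ × Fin n) ℂ) :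
    star (fun x : τ × τ => (1 : Matrix τ τ ℂ) x.1 x.2) ⬝ᵥ
      (blockMap (mapOfMatrix W) X *ᵥ fun x : τ × τ => (1 : Matrix τ τ ℂ) x.1 x.2)
      = pairing W X := by
  simp only [pairing, dotProduct, Matrix.mulVec, blockMap, mapOfMatrix,
    Pi.star_apply, Matrix.of_apply, LinearMap.coe_mk, AddHom.coe_mk, Matrix.submatrix_apply,
    Fintype.sum_prod_type, Matrix.one_apply, apply_ite (star : ℂ → ℂ), star_one, star_zero,
    mul_ite, mul_one, mul_zero, ite_mul, one_mul, zero_mul, Finset.sum_ite_eq, Finset.mem_univ,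
    if_true]
  exact Finset.sum_congr rfl fun _ _ => Finset.sum_comm

/-! ### Compactness of convex hulls -/

/-- The convex hull of a compact set of a finite-dimensional space is compact. -/
theorem IsCompact.convexHull_of_finiteDimensional {E : Type*} [NormedAddCommGroup E]
    [NormedSpace ℝ E] [FiniteDimensional ℝ E] {s : Set E} (hs : IsCompact s) :
    IsCompact (convexHull ℝ s) := by
  classical
  -- Carathéodory: this many points always suffice, so the hull is a continuous image of a simplex
  -- times a power of `s`. Shorter combinations are padded with zero weights at an arbitrary point
  -- of `s`.
  set d := Module.finrank ℝ E + 1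
  let K : Set ((Fin d → ℝ) × (Fin d → E)) := stdSimplex ℝ (Fin d) ×ˢ Set.univ.pi fun _ => s
  have hK : IsCompact K := (isCompact_stdSimplex ℝ (Fin d)).prod (isCompact_univ_pi fun _ => hs)
  let F : (Fin d → ℝ) × (Fin d → E) → E := fun x => ∑ i, x.1 i • x.2 i
  have hF : Continuous F := by fun_prop
  suffices convexHull ℝ s = F '' K by rw [this]; exact hK.image hF
  apply Set.Subset.antisymm
  · intro x hx
    obtain ⟨J, hJ, z, w, hz, hind, hw, hw1, hx⟩ := eq_pos_convex_span_of_mem_convexHull hx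
    have hcard : Fintype.card J ≤ Fintype.card (Fin d) := by
      rw [Fintype.card_fin]
      exact hind.card_le_finrank_succ.trans (Nat.succ_le_succ (Submodule.finrank_le _))
    obtain ⟨e⟩ := Function.Embedding.nonempty_of_card_le hcard
    have hJ0 : Nonempty J := by
      by_contra h0
      rw [not_nonempty_iff] at h0
      simp at hw1
    obtain ⟨j0⟩ := hJ0
    have hext : ∀ i ∉ Finset.univ.map e, Function.extend e w 0 i = 0 := fun i hi => by
      rw [Function.extend_apply' _ _ _ (by simpa using hi)]; rfl
    refine ⟨(Function.extend e w 0, Function.extend e z fun _ => z j0), ⟨⟨fun i => ?_, ?_⟩, ?_⟩, ?_⟩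
    · by_cases hi : ∃ j, e j = i
      · obtain ⟨j, rfl⟩ := hi
        simpa [e.injective.extend_apply] using (hw j).le
      · simp [Function.extend_apply' _ _ _ hi]
    · rw [← hw1, ← Finset.sum_subset (Finset.subset_univ (Finset.univ.map e))
        fun i _ hi => hext i hi, Finset.sum_map]
      simp [e.injective.extend_apply]
    · intro i _
      by_cases hi : ∃ j, e j = i
      · obtain ⟨j, rfl⟩ := hi
        simpa [e.injective.extend_apply] using hz ⟨j, rfl⟩
      · simpa [Function.extend_apply' _ _ _ hi] using hz ⟨j0, rfl⟩
    · change ∑ i, Function.extend e w 0 i • Function.extend e z (fun _ => z j0) i = x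
      rw [← hx, ← Finset.sum_subset (Finset.subset_univ (Finset.univ.map e))
        fun i _ hi => by rw [hext i hi, zero_smul], Finset.sum_map]
      simp [e.injective.extend_apply]
  · rintro _ ⟨⟨w, z⟩, ⟨hw, hz⟩, rfl⟩
    exact (convex_convexHull ℝ s).sum_mem (fun i _ => hw.1 i) hw.2
      fun i _ => subset_convexHull ℝ s (hz i trivial)

/-! ### Schmidt rank, tensor rank and Schmidt number -/

theorem HasSchmidtDecomposition.tensorRankLE {m r t : ℕ}
    {ψ : EuclideanSpace ℂ (Fin m × Fin n)} (h : HasSchmidtDecomposition ψ r) (hr : r ≤ t) :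
    TensorRankLE t ψ.ofLp := by
  obtain ⟨c, u, v, -, -, -, h⟩ := h
  obtain ⟨k, rfl⟩ := Nat.exists_eq_add_of_le hr
  refine ⟨Fin.append (fun i p => (Real.sqrt (c i) : ℂ) * u i p) fun _ _ => 0,
    Fin.append (fun i => (v i).ofLp) fun _ _ => 0, fun p q => ?_⟩
  simp [Fin.sum_univ_add, h, mul_assoc]

/-- Existence of a Schmidt decomposition with at most `t` terms. -/
theorem TensorRankLE.exists_hasSchmidtDecomposition {m t : ℕ}
    {ψ : EuclideanSpace ℂ (Fin m × Fin n)} (h : TensorRankLE t ψ.ofLp) :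
    ∃ r ≤ t, HasSchmidtDecomposition ψ r := by
  obtain ⟨a, b, hab⟩ := h
  let M : Matrix (Fin m) (Fin n) ℂ := Matrix.of fun p q => ψ (p, q)
  have hM : M.rank ≤ t := by
    have : M = (Matrix.of fun p i => a i p) * Matrix.of b := by
      ext p q; simp [M, Matrix.mul_apply, hab]
    rw [this]
    refine (Matrix.rank_mul_le_left _ _).trans ((Matrix.rank_le_card_width _).trans ?_)
    simp
  -- Singular value decomposition: for an eigenbasis `v` of `M* M`, the vectors `M v i` are
  -- orthogonal with squared norms `lam i`. Expanding `M = ∑ (M v i)(v i)*` and dropping zero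
  -- eigenvalues leaves `rank M` terms.
  have hH : (Mᴴ * M).IsHermitian := Matrix.isHermitian_conjTranspose_mul_self M
  let v := hH.eigenvectorBasis
  let lam := hH.eigenvalues
  let S := {i // lam i ≠ 0}
  have hS : Fintype.card S ≤ t := by
    rw [← hH.rank_eq_card_non_zero_eigs, Matrix.rank_conjTranspose_mul_self]
    exact hM
  have hinner : ∀ i j, inner ℂ (WithLp.toLp 2 (M *ᵥ (v i).ofLp)) (WithLp.toLp 2 (M *ᵥ (v j).ofLp))
      = if i = j then (lam j : ℂ) else 0 := by
    intro i j
    have e : (Mᴴ * M) *ᵥ (v j).ofLp = lam j • (v j).ofLp := hH.mulVec_eigenvectorBasis j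
    have e2 : inner ℂ (v i) (v j) = if i = j then (1 : ℂ) else 0 :=
      orthonormal_iff_ite.mp v.orthonormal i j
    rw [EuclideanSpace.inner_eq_star_dotProduct] at e2 ⊢
    simp only
    rw [dotProduct_comm, Matrix.star_mulVec, ← Matrix.dotProduct_mulVec, Matrix.mulVec_mulVec, e,
      dotProduct_smul, dotProduct_comm, e2]
    simp
  have hpos : ∀ i, 0 ≤ lam i := fun i => (Matrix.posSemidef_conjTranspose_mul_self M).eigenvalues_nonneg i
  have hzero : ∀ i, lam i = 0 → M *ᵥ (v i).ofLp = 0 := by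
    intro i hi
    have := hinner i i
    rw [if_pos rfl, hi] at this
    simpa using this
  have hexp : ∀ p q, ψ (p, q) = ∑ i : S, (M *ᵥ (v i).ofLp) p * star (v i q) := by
    intro p q
    have hU := hH.eigenvectorUnitary.2
    have h1 : M = (M * (hH.eigenvectorUnitary : CMat n)) * (hH.eigenvectorUnitary : CMat n)ᴴ := by
      rw [Matrix.mul_assoc, ← Matrix.star_eq_conjTranspose, (Matrix.mem_unitaryGroup_iff.mp hU), Matrix.mul_one]
    have h2 : ψ (p, q) = ∑ i, (M *ᵥ (v i).ofLp) p * star (v i q) := by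
      change M p q = _
      conv_lhs => rw [h1]
      simp [Matrix.mul_apply, Matrix.mulVec, dotProduct, v]
    rw [h2, ← Finset.sum_filter_of_ne (p := fun i => lam i ≠ 0)
      fun i _ hi h0 => hi (by rw [hzero i h0]; simp)]
    exact Finset.sum_subtype _ (by simp) _
  let e := (Fintype.equivFin S).symm
  have hS0 : ∀ i : S, 0 < lam i := fun i => (hpos i).lt_of_ne i.2.symm
  refine ⟨Fintype.card S, hS, fun k => lam (e k),
    fun k => (((Real.sqrt (lam (e k)))⁻¹ : ℝ) : ℂ) • WithLp.toLp 2 (M *ᵥ (v (e k)).ofLp),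
    fun k => WithLp.toLp 2 (star (v (e k)).ofLp), fun k => hS0 _, ?_, ?_, fun p q => ?_⟩
  · rw [orthonormal_iff_ite]
    intro i j
    rw [inner_smul_left, inner_smul_right, hinner]
    by_cases hij : i = j
    · subst hij
      have := hS0 (e i)
      rw [if_pos rfl, if_pos rfl, Complex.conj_ofReal, ← Complex.ofReal_mul, ← Complex.ofReal_mul,
        Complex.ofReal_eq_one]
      have h3 := Real.mul_self_sqrt this.le
      have h4 := (Real.sqrt_pos.mpr this).ne'
      field_simp
      nlinarith
    · rw [if_neg hij, if_neg fun h => hij (e.injective (Subtype.ext h))]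
      simp
  · rw [orthonormal_iff_ite]
    intro i j
    have e2 := orthonormal_iff_ite.mp v.orthonormal (e j) (e i)
    rw [EuclideanSpace.inner_eq_star_dotProduct] at e2 ⊢
    simp only [star_star]
    rw [dotProduct_comm, e2]
    simp [eq_comm, Subtype.ext_iff.symm]
  · rw [hexp, ← e.sum_comp]
    refine Finset.sum_congr rfl fun k _ => ?_
    have h4 : (Real.sqrt (lam (e k)) : ℂ) ≠ 0 := by
      exact_mod_cast (Real.sqrt_pos.mpr (hS0 (e k))).ne'
    simp
    field_simp

/-- Passing from `≤ t` to `< t + 1` in `ℕ∞` extracts an actual decomposition from the infimum. -/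
theorem schmidtRank_le_iff {m t : ℕ} {ψ : EuclideanSpace ℂ (Fin m × Fin n)} :
    schmidtRank ψ ≤ (t : ℕ∞) ↔ TensorRankLE t ψ.ofLp := by
  constructor
  · intro h
    have h' := (ENat.lt_add_one_iff (ENat.natCast_ne_top t)).mpr h
    simp only [schmidtRank, iInf_lt_iff] at h'
    obtain ⟨r, hr, hlt⟩ := h'
    exact hr.tensorRankLE (by exact_mod_cast (ENat.lt_add_one_iff (ENat.natCast_ne_top t)).mp hlt)
  · intro h
    obtain ⟨r, hr, hd⟩ := h.exists_hasSchmidtDecomposition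
    exact (iInf₂_le r hd).trans (by exact_mod_cast hr)

theorem schmidtNumber_le_iff {m t : ℕ} {ρ : CMat₂ m n} :
    schmidtNumber ρ ≤ (t : ℕ∞) ↔ ∃ (l : ℕ) (w : Fin l → ℝ)
      (ψ : Fin l → EuclideanSpace ℂ (Fin m × Fin n)),
      IsPureDecomposition ρ w ψ ∧ ∀ j, TensorRankLE t (ψ j).ofLp := by
  simp only [← schmidtRank_le_iff, ← iSup_le_iff]
  constructor
  · intro h
    have h' := (ENat.lt_add_one_iff (ENat.natCast_ne_top t)).mpr h
    simp only [schmidtNumber, iInf_lt_iff] at h'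
    obtain ⟨l, w, ψ, hd, hlt⟩ := h'
    exact ⟨l, w, ψ, hd, (ENat.lt_add_one_iff (ENat.natCast_ne_top t)).mp hlt⟩
  · rintro ⟨l, w, ψ, hd, hle⟩
    exact (iInf_le_of_le l <| iInf_le_of_le w <| iInf₂_le ψ hd).trans hle

theorem schmidtNumberLE_subset_undetectedStates {m t : ℕ} {N : ℕ} {Φ : CMat n →ₗ[ℂ] CMat N}
    (hΦ : IsTPositive t Φ) : schmidtNumberLE t m n ⊆ undetectedStates m Φ := by
  rintro ρ ⟨hρ, hs⟩
  obtain ⟨l, w, ψ, ⟨hw, -, -, rfl⟩, hr⟩ := schmidtNumber_le_iff.mp hs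
  refine ⟨hρ, ?_⟩
  rw [ampliation_eq_blockMap, blockMap_sum]
  refine Matrix.posSemidef_sum _ fun j _ => ?_
  rw [blockMap_smul]
  exact (IsBlockPositive.blockMap_vecMulVec hΦ (hr j)).smul (Complex.zero_le_real.mpr (hw j))

/-! ### Compactness of the low-rank states and separation -/

/-- The pure states with Schmidt rank at most `t`. -/
def pureStatesLE (t m n : ℕ) : Set (CMat₂ m n) :=
  {M | ∃ ψ : EuclideanSpace ℂ (Fin m × Fin n), ‖ψ‖ = 1 ∧ TensorRankLE t ψ.ofLp ∧
    M = Matrix.vecMulVec ψ.ofLp (star ψ.ofLp)}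

theorem schmidtNumber_le_of_mem_convexHull {t m : ℕ} {ρ : CMat₂ m n}
    (h : ρ ∈ convexHull ℝ (pureStatesLE t m n)) : schmidtNumber ρ ≤ t := by
  obtain ⟨J, _, w, z, hw, hw1, hz, rfl⟩ := mem_convexHull_iff_exists_fintype.mp h
  choose ψ h1 h2 h3 using hz
  let e := (Fintype.equivFin J).symm
  refine schmidtNumber_le_iff.mpr ⟨Fintype.card J, w ∘ e, ψ ∘ e,
    ⟨fun j => hw _, ?_, fun j => h1 _, ?_⟩, fun j => h2 _⟩
  · rw [← hw1]; exact e.sum_comp w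
  · rw [← e.sum_comp]
    refine Finset.sum_congr rfl fun j _ => ?_
    rw [h3]
    ext a b
    simp

/-- Arbitrary product decompositions can have huge cancelling terms; a Schmidt decomposition cannot.
Pairing `ψ` with `v i` expresses each left coefficient as a sum of `n` terms of modulus at most 1.
This crude bound is enough for compactness. -/
theorem TensorRankLE.exists_bounded {t m : ℕ} {ψ : EuclideanSpace ℂ (Fin m × Fin n)}
    (h : TensorRankLE t ψ.ofLp) (h1 : ‖ψ‖ = 1) :
    ∃ (a : Fin t → Fin m → ℂ) (b : Fin t → Fin n → ℂ), (∀ i p, ‖a i p‖ ≤ n) ∧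
      (∀ i q, ‖b i q‖ ≤ 1) ∧ ∀ p q, ψ (p, q) = ∑ i, a i p * b i q := by
  obtain ⟨r, hr, c, u, v, -, -, hv, hψ⟩ := h.exists_hasSchmidtDecomposition
  have hv1 : ∀ i q, ‖v i q‖ ≤ 1 := fun i q => (PiLp.norm_apply_le (v i) q).trans_eq (hv.1 i)
  have hc : ∀ i p, (Real.sqrt (c i) : ℂ) * u i p = ∑ q, ψ (p, q) * star (v i q) := by
    intro i p
    have hv2 : ∀ j, ∑ q, v j q * star (v i q) = if i = j then 1 else 0 := fun j => by
      have := orthonormal_iff_ite.mp hv i j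
      rwa [EuclideanSpace.inner_eq_star_dotProduct] at this
    simp only [hψ, Finset.sum_mul]
    rw [Finset.sum_comm]
    have : ∀ j, ∑ q, (Real.sqrt (c j) : ℂ) * (u j p * v j q) * star (v i q)
        = (Real.sqrt (c j) : ℂ) * u j p * ∑ q, v j q * star (v i q) := fun j => by
      rw [Finset.mul_sum]; exact Finset.sum_congr rfl fun _ _ => by ring
    simp only [this, hv2]
    simp
  have hcn : ∀ i p, ‖(Real.sqrt (c i) : ℂ) * u i p‖ ≤ n := by
    intro i p
    rw [hc]
    refine (norm_sum_le _ _).trans ((Finset.sum_le_card_nsmul _ _ 1 fun q _ => ?_).trans (by simp))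
    rw [norm_mul, norm_star]
    exact mul_le_one₀ ((PiLp.norm_apply_le ψ (p, q)).trans_eq h1) (norm_nonneg _) (hv1 i q)
  obtain ⟨k, rfl⟩ := Nat.exists_eq_add_of_le hr
  refine ⟨Fin.append (fun i p => (Real.sqrt (c i) : ℂ) * u i p) fun _ _ => 0,
    Fin.append (fun i => (v i).ofLp) fun _ _ => 0, fun i => ?_, fun i => ?_, fun p q => ?_⟩
  · refine Fin.addCases (fun i p => ?_) (fun i p => ?_) i
    · simpa using hcn i p
    · simp
  · refine Fin.addCases (fun i p => ?_) (fun i p => ?_) i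
    · simpa using hv1 i p
    · simp
  · simp [Fin.sum_univ_add, hψ, mul_assoc]

theorem isCompact_pureStatesLE (t m n : ℕ) : IsCompact (pureStatesLE t m n) := by
  let K : Set ((Fin t → Fin m → ℂ) × (Fin t → Fin n → ℂ)) :=
    (Set.univ.pi fun _ => Set.univ.pi fun _ => Metric.closedBall 0 n) ×ˢ
      (Set.univ.pi fun _ => Set.univ.pi fun _ => Metric.closedBall 0 1)
  have hK : IsCompact K :=
    (isCompact_univ_pi fun _ => isCompact_univ_pi fun _ => isCompact_closedBall _ _).prod
      (isCompact_univ_pi fun _ => isCompact_univ_pi fun _ => isCompact_closedBall _ _)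
  let F : (Fin t → Fin m → ℂ) × (Fin t → Fin n → ℂ) → EuclideanSpace ℂ (Fin m × Fin n) :=
    fun x => WithLp.toLp 2 fun y => ∑ i, x.1 i y.1 * x.2 i y.2
  have hF : Continuous F := by fun_prop
  let G : EuclideanSpace ℂ (Fin m × Fin n) → CMat₂ m n :=
    fun ψ => Matrix.vecMulVec ψ.ofLp (star ψ.ofLp)
  have hG : Continuous G := by
    refine continuous_matrix fun a b => ?_
    simp only [G, Matrix.vecMulVec_apply, Pi.star_apply]
    fun_prop
  have : pureStatesLE t m n = G '' (F '' K ∩ Metric.sphere 0 1) := by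
    ext M
    constructor
    · rintro ⟨ψ, h1, h2, rfl⟩
      obtain ⟨a, b, ha, hb, hab⟩ := h2.exists_bounded h1
      refine ⟨ψ, ⟨⟨(a, b), ⟨?_, ?_⟩, ?_⟩, by simpa using h1⟩, rfl⟩
      · simpa [Set.mem_pi] using ha
      · simpa [Set.mem_pi] using hb
      · ext ⟨p, q⟩; exact (hab p q).symm
    · rintro ⟨_, ⟨⟨x, -, rfl⟩, h1⟩, rfl⟩
      exact ⟨F x, by simpa using h1, ⟨x.1, x.2, fun _ _ => rfl⟩, rfl⟩
  rw [this]
  exact ((hK.image hF).inter_right Metric.isClosed_sphere).image hG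

theorem isClosed_convexHull_pureStatesLE (t m n : ℕ) :
    IsClosed (convexHull ℝ (pureStatesLE t m n)) := by
  let _ : NormedAddCommGroup (CMat₂ m n) := Matrix.normedAddCommGroup
  let _ : NormedSpace ℝ (CMat₂ m n) := Matrix.normedSpace
  exact (isCompact_pureStatesLE t m n).convexHull_of_finiteDimensional.isClosed

theorem exists_separating_functional {m : ℕ} {s : Set (CMat₂ m n)} {ρ : CMat₂ m n}
    (hs : Convex ℝ s) (hs' : IsClosed s) (h : ρ ∉ s) :
    ∃ (f : CMat₂ m n →ₗ[ℂ] ℂ) (u : ℝ), (f ρ).re < u ∧ ∀ x ∈ s, u < (f x).re := by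
  have : LocallyConvexSpace ℝ (CMat₂ m n) :=
    inferInstanceAs (LocallyConvexSpace ℝ (Fin m × Fin n → Fin m × Fin n → ℂ))
  obtain ⟨f, u, h1, h2⟩ := RCLike.geometric_hahn_banach_point_closed (𝕜 := ℂ) hs hs' h
  exact ⟨f, u, h1, h2⟩

/-- Hahn-Banach controls only real parts; replacing `W` by its Hermitian part makes the pairing with
Hermitian matrices equal to that real part. -/
theorem pairing_isHermitian [Fintype ι] (W : Matrix ι ι ℂ) {X : Matrix ι ι ℂ}
    (hX : X.IsHermitian) :
    pairing (Matrix.of fun a b => (W a b + star (W b a)) / 2) X = ((pairing W X).re : ℂ) := by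
  have h : star (pairing W X) = ∑ a, ∑ b, star (W b a) * X a b := by
    simp only [pairing, star_sum, star_mul']
    rw [Finset.sum_comm]
    refine Finset.sum_congr rfl fun a _ => Finset.sum_congr rfl fun b _ => ?_
    rw [hX.apply]
  have h2 : ((pairing W X).re : ℂ) = (pairing W X + star (pairing W X)) / 2 :=
    Complex.re_eq_add_conj _
  rw [h2, h, pairing, pairing, ← Finset.sum_add_distrib, Finset.sum_div]
  refine Finset.sum_congr rfl fun a _ => ?_
  rw [← Finset.sum_add_distrib, Finset.sum_div]
  exact Finset.sum_congr rfl fun b _ => by simp only [Matrix.of_apply]; ring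

/-- A state of Schmidt number larger than `t` is detected by a Schmidt number witness. -/
theorem exists_isRankPositive_pairing_neg {t m : ℕ} {ρ : CMat₂ m n} (hρ : ρ ∈ densityMatrices m n)
    (h : ρ ∉ schmidtNumberLE t m n) :
    ∃ W : CMat₂ m n, IsRankPositive t W ∧ ¬ 0 ≤ pairing W ρ := by
  have h' : ρ ∉ convexHull ℝ (pureStatesLE t m n) := fun hc =>
    h ⟨hρ, schmidtNumber_le_of_mem_convexHull hc⟩
  obtain ⟨f, u, hf, hu⟩ := exists_separating_functional (convex_convexHull ℝ _)
    (isClosed_convexHull_pureStatesLE t m n) h'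
  -- This matrix represents `f - u • trace`; since states have trace one, the separation threshold
  -- `u` moves to `0`.
  let W₀ : CMat₂ m n := Matrix.of fun a b => f (Matrix.single a b 1) - u * (1 : CMat₂ m n) a b
  have hW : ∀ X, pairing W₀ X = f X - u * X.trace := by
    intro X
    conv_rhs => rw [Matrix.matrix_eq_sum_single X]
    have hs : ∀ a b, Matrix.single a b (X a b) = X a b • Matrix.single a b (1 : ℂ) := by
      intro a b; simp
    simp only [map_sum, pairing, W₀, Matrix.of_apply, sub_mul, Finset.sum_sub_distrib]
    congr 1
    · refine Finset.sum_congr rfl fun a _ => Finset.sum_congr rfl fun b _ => ?_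
      rw [hs, map_smul, smul_eq_mul, mul_comm]
    · rw [← Matrix.matrix_eq_sum_single X]
      simp [Matrix.one_apply, Matrix.trace, Finset.mul_sum]
  refine ⟨Matrix.of fun a b => (W₀ a b + star (W₀ b a)) / 2, fun ψ hψ => ?_, ?_⟩
  · rw [pairing_isHermitian _ (Matrix.posSemidef_vecMulVec_self_star ψ).1, Complex.zero_le_real]
    let φ : EuclideanSpace ℂ (Fin m × Fin n) := WithLp.toLp 2 ψ
    by_cases h0 : ‖φ‖ = 0
    · have : ψ = 0 := by
        have : φ = 0 := norm_eq_zero.mp h0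
        simpa [φ] using this
      simp [this, pairing]
    · have hm : Matrix.vecMulVec ((‖φ‖⁻¹ : ℂ) • φ).ofLp (star ((‖φ‖⁻¹ : ℂ) • φ).ofLp) ∈
          pureStatesLE t m n := by
        refine ⟨_, ?_, ?_, rfl⟩
        · rw [norm_smul]; simp [h0]
        · obtain ⟨a, b, hab⟩ := hψ
          exact ⟨fun i p => (‖φ‖⁻¹ : ℂ) * a i p, b, fun p q => by
            simp [φ, hab, Finset.mul_sum, mul_assoc]⟩
      have h1 := hu _ (subset_convexHull ℝ _ hm)
      have hv : Matrix.vecMulVec ψ (star ψ) = ((‖φ‖ ^ 2 : ℝ) : ℂ) •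
          Matrix.vecMulVec ((‖φ‖⁻¹ : ℂ) • φ).ofLp (star ((‖φ‖⁻¹ : ℂ) • φ).ofLp) := by
        have h0' : (‖φ‖ : ℂ) ≠ 0 := by exact_mod_cast h0
        ext a b
        simp only [Matrix.vecMulVec_apply, Matrix.smul_apply, WithLp.ofLp_smul, Pi.smul_apply,
          Pi.star_apply, smul_eq_mul, star_mul', star_inv₀, Complex.star_def, Complex.conj_ofReal,
          Complex.ofReal_pow]
        field_simp
        rfl
      have htr : (Matrix.vecMulVec ((‖φ‖⁻¹ : ℂ) • φ).ofLp
          (star ((‖φ‖⁻¹ : ℂ) • φ).ofLp)).trace = 1 := by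
        rw [Matrix.trace_vecMulVec, ← EuclideanSpace.inner_eq_star_dotProduct,
          inner_self_eq_norm_sq_to_K, norm_smul]
        simp [h0]
      rw [hW, hv, map_smul, Matrix.trace_smul, htr, smul_eq_mul, smul_eq_mul, mul_one,
        Complex.sub_re, Complex.re_ofReal_mul, mul_comm (u : ℂ), Complex.re_ofReal_mul,
        Complex.ofReal_re, ← mul_sub]
      exact mul_nonneg (by positivity) (by linarith)
  · rw [pairing_isHermitian _ hρ.1.1, Complex.zero_le_real, hW, hρ.2]
    simpa using hf

/-! ### Haar averages over the unitary group -/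

noncomputable instance unitaryGroup.instMeasurableSpace (n : ℕ) :
    MeasurableSpace (Matrix.unitaryGroup (Fin n) ℂ) := borel _

instance unitaryGroup.instBorelSpace (n : ℕ) : BorelSpace (Matrix.unitaryGroup (Fin n) ℂ) := ⟨rfl⟩

instance unitaryGroup.instMetrizableSpace (n : ℕ) :
    TopologicalSpace.MetrizableSpace (Matrix.unitaryGroup (Fin n) ℂ) :=
  have : TopologicalSpace.MetrizableSpace (CMat n) :=
    inferInstanceAs (TopologicalSpace.MetrizableSpace (Fin n → Fin n → ℂ))
  Topology.IsEmbedding.subtypeVal.metrizableSpace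

instance unitaryGroup.instCompactSpace (n : ℕ) :
    CompactSpace (Matrix.unitaryGroup (Fin n) ℂ) := by
  refine isCompact_iff_compactSpace (s := (Matrix.unitaryGroup (Fin n) ℂ : Set (CMat n))).mp ?_
  have h : IsCompact (Set.univ.pi fun _ : Fin n => Set.univ.pi fun _ : Fin n =>
      Metric.closedBall (0 : ℂ) 1) :=
    isCompact_univ_pi fun _ => isCompact_univ_pi fun _ => isCompact_closedBall _ _
  refine IsCompact.of_isClosed_subset (X := CMat n) h isClosed_unitary fun U hU => ?_
  exact fun i _ j _ => mem_closedBall_zero_iff.mpr (entry_norm_bound_of_unitary hU i j)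

open MeasureTheory

theorem unitaryGroup.integrable {f : Matrix.unitaryGroup (Fin n) ℂ → ℂ} (hf : Continuous f) :
    Integrable f Measure.haar :=
  hf.integrable_of_hasCompactSupport (.of_compactSpace f)

/-- The Haar average of a continuous family of linear maps. -/
noncomputable def haarAverage
    (G : Matrix.unitaryGroup (Fin n) ℂ → CMat n →ₗ[ℂ] Matrix κ κ ℂ)
    (hG : ∀ X a b, Continuous fun A => G A X a b) : CMat n →ₗ[ℂ] Matrix κ κ ℂ where
  toFun X := Matrix.of fun a b => ∫ A, G A X a b ∂Measure.haar
  map_add' X Y := by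
    ext a b
    simp only [map_add, Matrix.add_apply, Matrix.of_apply]
    exact integral_add (unitaryGroup.integrable (hG X a b)) (unitaryGroup.integrable (hG Y a b))
  map_smul' c X := by
    ext a b
    simp only [map_smul, Matrix.smul_apply, Matrix.of_apply, smul_eq_mul, RingHom.id_apply]
    exact integral_const_mul _ _

section haarAverage

variable {G : Matrix.unitaryGroup (Fin n) ℂ → CMat n →ₗ[ℂ] Matrix κ κ ℂ}
  {hG : ∀ X a b, Continuous fun A => G A X a b}

theorem haarAverage_apply (X : CMat n) (a b : κ) :
    haarAverage G hG X a b = ∫ A, G A X a b ∂Measure.haar := rfl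

theorem dotProduct_blockMap_haarAverage [Fintype τ] [Fintype κ]
    (X : Matrix (τ × Fin n) (τ × Fin n) ℂ) (z : τ × κ → ℂ) :
    star z ⬝ᵥ (blockMap (haarAverage G hG) X *ᵥ z)
      = ∫ A, star z ⬝ᵥ (blockMap (G A) X *ᵥ z) ∂Measure.haar := by
  simp only [dotProduct, Matrix.mulVec, Finset.mul_sum]
  have hi : ∀ a b, Integrable (fun A => star z a * (blockMap (G A) X a b * z b))
      Measure.haar := fun a b =>
    unitaryGroup.integrable (((hG _ a.2 b.2).mul continuous_const).const_mul _)
  rw [integral_finsetSum _ fun a _ => integrable_finsetSum _ fun b _ => hi a b]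
  refine Finset.sum_congr rfl fun a _ => ?_
  rw [integral_finsetSum _ fun b _ => hi a b]
  refine Finset.sum_congr rfl fun b _ => ?_
  rw [integral_const_mul, integral_mul_const]
  rfl

theorem isBlockPositive_haarAverage [Fintype κ] {t : ℕ} (h : ∀ A, IsBlockPositive t (G A)) :
    IsBlockPositive t (haarAverage G hG) := by
  refine fun X hX => Matrix.posSemidef_of_forall_nonneg fun z => ?_
  rw [dotProduct_blockMap_haarAverage]
  exact integral_nonneg fun A => (h A X hX).dotProduct_mulVec_nonneg z

/-- Left invariance of Haar measure turns covariance under `A ↦ U A` into equivariance of the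
average. -/
theorem haarAverage_conj [Fintype κ] {U : Matrix.unitaryGroup (Fin n) ℂ} {V : Matrix κ κ ℂ}
    (h : ∀ A X, G (U * A) ((U : CMat n) * X * (U : CMat n)ᴴ) = V * G A X * Vᴴ) (X : CMat n) :
    haarAverage G hG ((U : CMat n) * X * (U : CMat n)ᴴ) = V * haarAverage G hG X * Vᴴ := by
  ext a b
  rw [haarAverage_apply, ← integral_mul_left_eq_self _ U]
  simp only [h, Matrix.mul_apply, haarAverage_apply, Finset.sum_mul]
  have hi : ∀ c d, Integrable (fun A => V a d * G A X d c * Vᴴ c b) Measure.haar := fun c d =>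
    unitaryGroup.integrable ((continuous_const.mul (hG X d c)).mul continuous_const)
  rw [integral_finsetSum _ fun c _ => integrable_finsetSum _ fun d _ => hi c d]
  refine Finset.sum_congr rfl fun c _ => ?_
  rw [integral_finsetSum _ fun d _ => hi c d]
  refine Finset.sum_congr rfl fun d _ => ?_
  rw [integral_mul_const, integral_const_mul]

end haarAverage

/-! ### Tensor powers and the equivariant twirl -/

/-- The `k`-th tensor power of a vector. -/
def vecTensorPow (k : ℕ) (ω : ι → ℂ) : (Fin k → ι) → ℂ := fun f => ∏ i, ω (f i)

/-- The `k`-th tensor power of a matrix. -/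
def matTensorPow (k : ℕ) (S : Matrix ι ι ℂ) : Matrix (Fin k → ι) (Fin k → ι) ℂ :=
  Matrix.of fun f g => ∏ i, S (f i) (g i)

theorem dotProduct_vecTensorPow [Fintype ι] (k : ℕ) (ω ω' : ι → ℂ) :
    vecTensorPow k ω ⬝ᵥ vecTensorPow k ω' = (ω ⬝ᵥ ω') ^ k := by
  simp only [dotProduct, vecTensorPow, ← Finset.prod_mul_distrib]
  rw [← Fintype.prod_sum fun (_ : Fin k) j => ω j * ω' j]
  simp

theorem star_vecTensorPow (k : ℕ) (ω : ι → ℂ) :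
    star (vecTensorPow k ω) = vecTensorPow k (star ω) := by
  ext f
  simp [vecTensorPow]

theorem matTensorPow_mulVec [Fintype ι] (k : ℕ) (S : Matrix ι ι ℂ) (ω : ι → ℂ) :
    matTensorPow k S *ᵥ vecTensorPow k ω = vecTensorPow k (S *ᵥ ω) := by
  ext f
  simp only [Matrix.mulVec, dotProduct, vecTensorPow, matTensorPow, Matrix.of_apply,
    ← Finset.prod_mul_distrib]
  exact (Fintype.prod_sum fun i j => S (f i) j * ω j).symm

theorem matTensorPow_mul [Fintype ι] (k : ℕ) (S T : Matrix ι ι ℂ) :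
    matTensorPow k S * matTensorPow k T = matTensorPow k (S * T) := by
  ext f g
  simp only [Matrix.mul_apply, matTensorPow, Matrix.of_apply, ← Finset.prod_mul_distrib]
  exact (Fintype.prod_sum fun i j => S (f i) j * T j (g i)).symm

theorem matTensorPow_one [DecidableEq ι] (k : ℕ) :
    matTensorPow k (1 : Matrix ι ι ℂ) = 1 := by
  ext f g
  simp [matTensorPow, Matrix.one_apply, Finset.prod_ite_zero, funext_iff]

theorem matTensorPow_conjTranspose (k : ℕ) (S : Matrix ι ι ℂ) :
    (matTensorPow k S)ᴴ = matTensorPow k Sᴴ := by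
  ext f g
  simp [matTensorPow, Matrix.conjTranspose_apply]

/-- The vector `1 ⊕ vec A`. -/
def augmentedVec (A : CMat n) : Unit ⊕ Fin n × Fin n → ℂ := Sum.elim 1 fun x => A x.1 x.2

/-- The action of left multiplication by `U` on the vectors `1 ⊕ vec A`. -/
def augmentedMul (U : CMat n) : Matrix (Unit ⊕ Fin n × Fin n) (Unit ⊕ Fin n × Fin n) ℂ :=
  Matrix.fromBlocks 1 0 0 (U ⊗ₖ 1)

/-- The extra coordinate `1` fixes the phase: `|tr A|` is maximal at every scalar unitary, whereas
`|1 + tr A|` is maximal only at the identity. -/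
theorem augmentedVec_dotProduct_one (A : CMat n) :
    star (augmentedVec A) ⬝ᵥ augmentedVec 1 = star (1 + A.trace) := by
  simp [augmentedVec, dotProduct, Fintype.sum_prod_type, Matrix.one_apply, Matrix.trace]

theorem augmentedMul_mulVec (U A : CMat n) :
    augmentedMul U *ᵥ augmentedVec A = augmentedVec (U * A) := by
  ext x
  rcases x with x | ⟨i, j⟩
  · simp [augmentedMul, augmentedVec, Matrix.fromBlocks_mulVec]
  · simp [augmentedMul, augmentedVec, Matrix.mulVec, dotProduct,
      Fintype.sum_prod_type, Matrix.one_apply, Matrix.mul_apply]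

theorem augmentedMul_mul_conjTranspose {U : CMat n} (hU : U * Uᴴ = 1) :
    augmentedMul U * (augmentedMul U)ᴴ = 1 := by
  simp [augmentedMul, Matrix.fromBlocks_conjTranspose, Matrix.fromBlocks_multiply,
    Matrix.conjTranspose_kronecker, ← Matrix.mul_kronecker_mul, hU]

/-- The index type of the `k`-th tensor power of the space of the vectors `1 ⊕ vec A`. -/
abbrev PowIndex (k n : ℕ) : Type := Fin k → Unit ⊕ Fin n × Fin n

/-- The map `X ↦ |w⟩⟨w| ⊗ Ψ(A* X A)`, where `w` is the `k`-th tensor power of `1 ⊕ vec A`. -/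
def twistedMap (k : ℕ) (Ψ : CMat n →ₗ[ℂ] Matrix τ τ ℂ) (A : CMat n) :
    CMat n →ₗ[ℂ] Matrix (PowIndex k n × τ) (PowIndex k n × τ) ℂ where
  toFun X := Matrix.vecMulVec (vecTensorPow k (augmentedVec A))
    (star (vecTensorPow k (augmentedVec A))) ⊗ₖ Ψ (Aᴴ * X * A)
  map_add' X Y := by rw [mul_add, add_mul, map_add, Matrix.kronecker_add]
  map_smul' c X := by
    rw [mul_smul_comm, smul_mul_assoc, map_smul, Matrix.kronecker_smul, RingHom.id_apply]

theorem blockMap_one_kronecker_conj [Fintype σ] [DecidableEq σ]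
    (Ψ : CMat n →ₗ[ℂ] Matrix τ τ ℂ) (A : CMat n) (X : Matrix (σ × Fin n) (σ × Fin n) ℂ)
    (a b : σ × τ) :
    blockMap Ψ (((1 : Matrix σ σ ℂ) ⊗ₖ A)ᴴ * X * ((1 : Matrix σ σ ℂ) ⊗ₖ A)) a b
      = Ψ (Aᴴ * X.submatrix (Prod.mk a.1) (Prod.mk b.1) * A) a.2 b.2 := by
  have hX : ∀ i j, (((1 : Matrix σ σ ℂ) ⊗ₖ A)ᴴ * X * ((1 : Matrix σ σ ℂ) ⊗ₖ A)).submatrix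
      (Prod.mk i) (Prod.mk j) = Aᴴ * X.submatrix (Prod.mk i) (Prod.mk j) * A := by
    intro i j
    ext p q
    simp [Matrix.mul_apply, Fintype.sum_prod_type, Matrix.one_apply, Matrix.conjTranspose_apply,
      apply_ite (star : ℂ → ℂ), Finset.sum_mul]
  rw [blockMap, Matrix.of_apply, hX]

theorem blockMap_twistedMap_apply (k : ℕ) (Ψ : CMat n →ₗ[ℂ] Matrix τ τ ℂ) (A : CMat n)
    (X : Matrix (σ × Fin n) (σ × Fin n) ℂ) (a b : σ × PowIndex k n × τ) :
    blockMap (twistedMap k Ψ A) X a b =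
      vecTensorPow k (augmentedVec A) a.2.1 * star (vecTensorPow k (augmentedVec A) b.2.1) *
        Ψ (Aᴴ * X.submatrix (Prod.mk a.1) (Prod.mk b.1) * A) a.2.2 b.2.2 := rfl

/-- The rank-one factor contracts the auxiliary index of `z` against `w_A`, leaving the quadratic
form of `Ψ` at the rotated matrix. -/
theorem dotProduct_blockMap_twistedMap [Fintype σ] [DecidableEq σ] [Fintype τ] (k : ℕ)
    (Ψ : CMat n →ₗ[ℂ] Matrix τ τ ℂ) (A : CMat n) (X : Matrix (σ × Fin n) (σ × Fin n) ℂ)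
    (z : σ × PowIndex k n × τ → ℂ) :
    star z ⬝ᵥ (blockMap (twistedMap k Ψ A) X *ᵥ z) =
      star (fun x : σ × τ => star (vecTensorPow k (augmentedVec A)) ⬝ᵥ fun f => z (x.1, f, x.2)) ⬝ᵥ
        (blockMap Ψ (((1 : Matrix σ σ ℂ) ⊗ₖ A)ᴴ * X * ((1 : Matrix σ σ ℂ) ⊗ₖ A)) *ᵥ
          fun x : σ × τ => star (vecTensorPow k (augmentedVec A)) ⬝ᵥ fun f => z (x.1, f, x.2)) := by
  simp only [dotProduct, Matrix.mulVec, blockMap_one_kronecker_conj, blockMap_twistedMap_apply,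
    Pi.star_apply, Fintype.sum_prod_type, star_sum, star_mul', star_star, Finset.sum_mul,
    Finset.mul_sum]
  refine Finset.sum_congr rfl fun i _ => ?_
  rw [Finset.sum_comm]
  refine Finset.sum_congr rfl fun p _ => ?_
  refine Finset.sum_comm.trans (Finset.sum_congr rfl fun j _ => ?_)
  refine Finset.sum_comm.trans (Eq.trans ?_ Finset.sum_comm)
  refine Finset.sum_congr rfl fun g _ => Finset.sum_comm.trans ?_
  exact Finset.sum_congr rfl fun q _ => Finset.sum_congr rfl fun f _ => by ring

theorem isBlockPositive_twistedMap [Fintype τ] {t : ℕ} {Ψ : CMat n →ₗ[ℂ] Matrix τ τ ℂ}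
    (h : IsBlockPositive t Ψ) (k : ℕ) (A : CMat n) : IsBlockPositive t (twistedMap k Ψ A) := by
  refine fun X hX => Matrix.posSemidef_of_forall_nonneg fun z => ?_
  rw [dotProduct_blockMap_twistedMap]
  exact (h _ (hX.conjTranspose_mul_mul_same _)).dotProduct_mulVec_nonneg _

theorem continuous_conj_apply (Ψ : CMat n →ₗ[ℂ] Matrix τ τ ℂ) (X : CMat n) (p q : τ) :
    Continuous fun A : Matrix.unitaryGroup (Fin n) ℂ => Ψ ((A : CMat n)ᴴ * X * (A : CMat n)) p q := by
  have h : Continuous fun Y : CMat n => Ψ Y p q :=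
    ((Matrix.entryLinearMap ℂ ℂ p q).comp Ψ).continuous_of_finiteDimensional
  have h2 : Continuous fun A : Matrix.unitaryGroup (Fin n) ℂ => (A : CMat n) :=
    continuous_subtype_val
  exact h.comp ((h2.matrix_conjTranspose.matrix_mul continuous_const).matrix_mul h2)

theorem continuous_twistedMap (k : ℕ) (Ψ : CMat n →ₗ[ℂ] Matrix τ τ ℂ) (X : CMat n)
    (a b : PowIndex k n × τ) :
    Continuous fun A : Matrix.unitaryGroup (Fin n) ℂ => twistedMap k Ψ (A : CMat n) X a b := by
  have h2 : Continuous fun A : Matrix.unitaryGroup (Fin n) ℂ => (A : CMat n) :=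
    continuous_subtype_val
  have hv : ∀ x, Continuous fun A : Matrix.unitaryGroup (Fin n) ℂ => augmentedVec (A : CMat n) x := by
    rintro (x | x)
    · exact continuous_const
    · exact h2.matrix_elem _ _
  have hw : ∀ f, Continuous fun A : Matrix.unitaryGroup (Fin n) ℂ =>
      vecTensorPow k (augmentedVec (A : CMat n)) f :=
    fun f => continuous_finsetProd _ fun i _ => hv (f i)
  exact ((hw _).mul (hw _).star).mul (continuous_conj_apply Ψ X _ _)

/-- The equivariant map obtained by averaging the maps `twistedMap k Ψ A`. -/
noncomputable def twirl (k : ℕ) (Ψ : CMat n →ₗ[ℂ] Matrix τ τ ℂ) :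
    CMat n →ₗ[ℂ] Matrix (PowIndex k n × τ) (PowIndex k n × τ) ℂ :=
  haarAverage (fun A => twistedMap k Ψ (A : CMat n)) (continuous_twistedMap k Ψ)

theorem isBlockPositive_twirl [Fintype τ] {t : ℕ} {Ψ : CMat n →ₗ[ℂ] Matrix τ τ ℂ}
    (h : IsBlockPositive t Ψ) (k : ℕ) : IsBlockPositive t (twirl k Ψ) :=
  isBlockPositive_haarAverage fun A => isBlockPositive_twistedMap h k A

/-- Unitary equivariance for maps into matrices with an arbitrary index type. -/
def IsEquivariant [Fintype κ] [DecidableEq κ] (Φ : CMat n →ₗ[ℂ] Matrix κ κ ℂ) : Prop :=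
  ∀ U ∈ Matrix.unitaryGroup (Fin n) ℂ, ∃ V ∈ Matrix.unitaryGroup κ ℂ,
    ∀ X : CMat n, Φ (U * X * Uᴴ) = V * Φ X * Vᴴ

theorem isEquivariant_twirl [Fintype τ] [DecidableEq τ] (k : ℕ) (Ψ : CMat n →ₗ[ℂ] Matrix τ τ ℂ) :
    IsEquivariant (twirl k Ψ) := by
  intro U hU
  have hU1 : U * Uᴴ = 1 := Matrix.mem_unitaryGroup_iff.mp hU
  have hU2 : Uᴴ * U = 1 := Matrix.mem_unitaryGroup_iff'.mp hU
  -- Replacing `(A, X)` by `(U A, U X U*)` leaves `A* X A` unchanged and only moves `w_A`, by this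
  -- tensor power.
  refine ⟨matTensorPow k (augmentedMul U) ⊗ₖ 1, ?_, haarAverage_conj (U := ⟨U, hU⟩) fun A X => ?_⟩
  · rw [Matrix.mem_unitaryGroup_iff, Matrix.star_eq_conjTranspose, Matrix.conjTranspose_kronecker,
      ← Matrix.mul_kronecker_mul, matTensorPow_conjTranspose, matTensorPow_mul,
      augmentedMul_mul_conjTranspose hU1, matTensorPow_one]
    simp
  · have h1 : (U * (A : CMat n))ᴴ * (U * X * Uᴴ) * (U * (A : CMat n))
        = (A : CMat n)ᴴ * X * (A : CMat n) := by
      rw [Matrix.conjTranspose_mul]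
      calc _ = (A : CMat n)ᴴ * (Uᴴ * U) * X * (Uᴴ * U) * (A : CMat n) := by
            simp only [Matrix.mul_assoc]
        _ = _ := by rw [hU2]; simp
    change Matrix.vecMulVec (vecTensorPow k (augmentedVec (U * (A : CMat n))))
        (star (vecTensorPow k (augmentedVec (U * (A : CMat n))))) ⊗ₖ Ψ _ =
      _ * (Matrix.vecMulVec (vecTensorPow k (augmentedVec (A : CMat n)))
        (star (vecTensorPow k (augmentedVec (A : CMat n)))) ⊗ₖ Ψ _) * _
    erw [h1]
    rw [Matrix.conjTranspose_kronecker, ← Matrix.mul_kronecker_mul, ← Matrix.mul_kronecker_mul,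
      Matrix.mul_vecMulVec, Matrix.vecMulVec_mul, ← Matrix.star_mulVec, matTensorPow_mulVec,
      augmentedMul_mulVec]
    simp

/-! ### Concentration at the identity -/

/-- Expand `|1 + tr A|² = 1 + 2 Re tr A + |tr A|²`. Here `|tr A| ≤ n`, and `Re tr A < n` because `tr
(A - 1)*(A - 1) = 2n - 2 Re tr A` is positive. -/
theorem normSq_one_add_trace_lt {A : CMat n} (hA : A ∈ Matrix.unitaryGroup (Fin n) ℂ)
    (h : A ≠ 1) : Complex.normSq (1 + A.trace) < Complex.normSq (1 + (1 : CMat n).trace) := by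
  have h1 : Aᴴ * A = 1 := Matrix.mem_unitaryGroup_iff'.mp hA
  have hps := (Matrix.posSemidef_conjTranspose_mul_self (A - 1)).trace_nonneg
  have hne : ((A - 1)ᴴ * (A - 1)).trace ≠ 0 := fun h0 =>
    h (sub_eq_zero.mp (Matrix.trace_conjTranspose_mul_self_eq_zero_iff.mp h0))
  have he : ((A - 1)ᴴ * (A - 1)).trace = 2 * n - A.trace - star A.trace := by
    rw [Matrix.conjTranspose_sub, Matrix.conjTranspose_one, sub_mul, mul_sub, mul_sub, h1,
      one_mul, one_mul, mul_one, Matrix.trace_sub, Matrix.trace_sub, Matrix.trace_sub,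
      Matrix.trace_conjTranspose, Matrix.trace_one, Fintype.card_fin]
    ring
  have hpos := (Complex.pos_iff.mp (hps.lt_of_ne hne.symm)).1
  rw [he] at hpos
  simp at hpos
  have hb : ‖A.trace‖ ≤ n :=
    (norm_sum_le _ _).trans ((Finset.sum_le_card_nsmul _ _ 1 fun i _ =>
      entry_norm_bound_of_unitary hA i i).trans (by simp))
  have hb2 : Complex.normSq A.trace ≤ n * n := by
    rw [Complex.normSq_eq_norm_sq, sq]
    exact mul_self_le_mul_self (norm_nonneg _) hb
  rw [Complex.normSq_apply] at hb2
  simp [Complex.normSq_apply]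
  nlinarith

/-- If all maps `twirl k Ψ` fail to detect `X`, so does `Ψ`. -/
theorem dotProduct_blockMap_nonneg_of_twirl [Fintype σ] [DecidableEq σ] [Fintype τ]
    {Ψ : CMat n →ₗ[ℂ] Matrix τ τ ℂ} {X : Matrix (σ × Fin n) (σ × Fin n) ℂ}
    (h : ∀ k, (blockMap (twirl k Ψ) X).PosSemidef) (y : σ × τ → ℂ) :
    0 ≤ star y ⬝ᵥ (blockMap Ψ X *ᵥ y) := by
  let c : Matrix.unitaryGroup (Fin n) ℂ → ℝ := fun A => Complex.normSq (1 + (A : CMat n).trace)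
  let g : Matrix.unitaryGroup (Fin n) ℂ → ℂ := fun A => star y ⬝ᵥ (blockMap Ψ
    (((1 : Matrix σ σ ℂ) ⊗ₖ (A : CMat n))ᴴ * X * ((1 : Matrix σ σ ℂ) ⊗ₖ (A : CMat n))) *ᵥ y)
  have hc : Continuous c :=
    Complex.continuous_normSq.comp (continuous_const.add continuous_subtype_val.matrix_trace)
  have hg : Continuous g := by
    simp only [g, dotProduct, Matrix.mulVec, blockMap_one_kronecker_conj]
    exact continuous_finsetSum _ fun a _ => continuous_const.mul <| continuous_finsetSum _
      fun b _ => (continuous_conj_apply Ψ _ _ _).mul continuous_const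
  -- Peak functions: the averages of `g` with normalised weights `c ^ k` tend to `g 1`, so it is
  -- enough that each of them is nonnegative.
  have hpeak := tendsto_setIntegral_pow_smul_of_unique_maximum_of_isCompact_of_continuousOn
    (μ := (Measure.haar : Measure (Matrix.unitaryGroup (Fin n) ℂ))) (x₀ := 1) (c := c) (g := g)
    isCompact_univ hc.continuousOn
    (fun A _ hA => normSq_one_add_trace_lt A.2 fun h1 => hA (Subtype.ext h1))
    (fun A _ => Complex.normSq_nonneg _) (by
      simp only [c, OneMemClass.coe_one, Matrix.trace_one, Fintype.card_fin]
      exact Complex.normSq_pos.mpr (by norm_cast; omega))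
    (by simp) hg.continuousOn
  have h1 : g 1 = star y ⬝ᵥ (blockMap Ψ X *ᵥ y) := by simp [g]
  rw [← h1]
  refine ge_of_tendsto' hpeak fun k => ?_
  -- The test vector `w_1 ⊗ y` contracts with `w_A` to a multiple of `y` by `(1 + tr A)^k` up to
  -- conjugation, which yields the weight `c A ^ k`.
  have hk : ∫ A, c A ^ k • g A ∂Measure.haar =
      star (fun x : σ × PowIndex k n × τ => vecTensorPow k (augmentedVec 1) x.2.1 * y (x.1, x.2.2)) ⬝ᵥ
      (blockMap (twirl k Ψ) X *ᵥ
        fun x => vecTensorPow k (augmentedVec 1) x.2.1 * y (x.1, x.2.2)) := by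
    rw [twirl, dotProduct_blockMap_haarAverage]
    refine integral_congr_ae (.of_forall fun A => ?_)
    simp only
    have hz : (fun x : σ × τ => star (vecTensorPow k (augmentedVec (A : CMat n))) ⬝ᵥ
        fun f => vecTensorPow k (augmentedVec 1) f * y (x.1, x.2)) =
        star (1 + (A : CMat n).trace) ^ k • y := by
      ext x
      rw [← augmentedVec_dotProduct_one, ← dotProduct_vecTensorPow, star_vecTensorPow]
      simp only [dotProduct, Finset.sum_mul, mul_assoc, Pi.smul_apply, smul_eq_mul]
    rw [dotProduct_blockMap_twistedMap, hz, star_smul, Matrix.mulVec_smul, dotProduct_smul,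
      smul_dotProduct, smul_smul, star_pow, star_star, ← mul_pow]
    have : star (1 + (A : CMat n).trace) * (1 + (A : CMat n).trace) = (c A : ℂ) :=
      (Complex.normSq_eq_conj_mul_self).symm
    rw [this, ← Complex.ofReal_pow, Complex.coe_smul]
  rw [setIntegral_univ, setIntegral_univ, hk]
  exact smul_nonneg (inv_nonneg.mpr (integral_nonneg fun A => pow_nonneg (Complex.normSq_nonneg _) k))
    ((h k).dotProduct_mulVec_nonneg _)

/-! ### Relabelling and direct sums -/

section reindex

variable [Fintype κ]

/-- Relabel the codomain of a linear map by `Fin (card κ)`. -/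
noncomputable def toFinMap (Φ : CMat n →ₗ[ℂ] Matrix κ κ ℂ) :
    CMat n →ₗ[ℂ] CMat (Fintype.card κ) :=
  (Matrix.reindexLinearEquiv ℂ ℂ (Fintype.equivFin κ) (Fintype.equivFin κ)).toLinearMap ∘ₗ Φ

theorem blockMap_toFinMap_posSemidef_iff (Φ : CMat n →ₗ[ℂ] Matrix κ κ ℂ)
    (X : Matrix (τ × Fin n) (τ × Fin n) ℂ) :
    (blockMap (toFinMap Φ) X).PosSemidef ↔ (blockMap Φ X).PosSemidef :=
  Matrix.posSemidef_submatrix_equiv (M := blockMap Φ X)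
    ((Equiv.refl τ).prodCongr (Fintype.equivFin κ).symm)

theorem IsEquivariant.toFinMap [DecidableEq κ] {Φ : CMat n →ₗ[ℂ] Matrix κ κ ℂ}
    (h : IsEquivariant Φ) : IsUnitarilyEquivariant (toFinMap Φ) := by
  intro U hU
  obtain ⟨V, hV, hΦ⟩ := h U hU
  refine ⟨V.submatrix (Fintype.equivFin κ).symm (Fintype.equivFin κ).symm, ?_, fun X => ?_⟩
  · rw [Matrix.mem_unitaryGroup_iff, Matrix.star_eq_conjTranspose] at hV ⊢
    rw [Matrix.conjTranspose_submatrix, Matrix.submatrix_mul_equiv, hV, Matrix.submatrix_one_equiv]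
  · simp only [_root_.toFinMap, LinearMap.comp_apply, LinearEquiv.coe_coe,
      Matrix.coe_reindexLinearEquiv, Matrix.reindex_apply, hΦ, Matrix.conjTranspose_submatrix,
      Matrix.submatrix_mul_equiv]

end reindex

section blockSum

variable {o : Type*} [Fintype o] [DecidableEq o] {β : o → Type*} [∀ i, Fintype (β i)]

/-- The direct sum of a finite family of linear maps. -/
def blockSum (F : ∀ i, CMat n →ₗ[ℂ] Matrix (β i) (β i) ℂ) :
    CMat n →ₗ[ℂ] Matrix (Σ i, β i) (Σ i, β i) ℂ where
  toFun X := Matrix.blockDiagonal' fun i => F i X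
  map_add' X Y := by simp only [map_add]; exact Matrix.blockDiagonal'_add _ _
  map_smul' c X := by simp only [map_smul]; exact Matrix.blockDiagonal'_smul c _

theorem blockMap_blockSum_posSemidef_iff [Fintype τ]
    (F : ∀ i, CMat n →ₗ[ℂ] Matrix (β i) (β i) ℂ) (X : Matrix (τ × Fin n) (τ × Fin n) ℂ) :
    (blockMap (blockSum F) X).PosSemidef ↔ ∀ i, (blockMap (F i) X).PosSemidef := by
  constructor
  · intro h i
    have := h.submatrix fun x : τ × β i => (x.1, (⟨i, x.2⟩ : Σ i, β i))
    convert this using 1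
    ext a b
    exact (Matrix.blockDiagonal'_apply_eq
      (fun i => F i (X.submatrix (Prod.mk a.1) (Prod.mk b.1))) i a.2 b.2).symm
  · intro h
    refine Matrix.posSemidef_of_forall_nonneg fun z => ?_
    have : star z ⬝ᵥ (blockMap (blockSum F) X *ᵥ z) =
        ∑ i, star (fun x : τ × β i => z (x.1, ⟨i, x.2⟩)) ⬝ᵥ
          (blockMap (F i) X *ᵥ fun x : τ × β i => z (x.1, ⟨i, x.2⟩)) := by
      have hb : ∀ a b i p j q, blockMap (blockSum F) X (a, ⟨i, p⟩) (b, ⟨j, q⟩) =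
          Matrix.blockDiagonal' (fun i => F i (X.submatrix (Prod.mk a) (Prod.mk b)))
            ⟨i, p⟩ ⟨j, q⟩ := fun _ _ _ _ _ _ => rfl
      simp only [dotProduct, Matrix.mulVec, Fintype.sum_prod_type, Fintype.sum_sigma, hb,
        Pi.star_apply]
      rw [Finset.sum_comm]
      refine Finset.sum_congr rfl fun i _ => Finset.sum_congr rfl fun a _ =>
        Finset.sum_congr rfl fun p _ => ?_
      congr 1
      refine Finset.sum_congr rfl fun b _ => ?_
      rw [Finset.sum_eq_single i]
      · simp only [Matrix.blockDiagonal'_apply_eq]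
        rfl
      · intro j _ hj
        simp only [Matrix.blockDiagonal'_apply_ne _ _ _ hj.symm, zero_mul, Finset.sum_const_zero]
      · simp
    rw [this]
    exact Finset.sum_nonneg fun i _ => (h i).dotProduct_mulVec_nonneg _

theorem isEquivariant_blockSum [∀ i, DecidableEq (β i)]
    {F : ∀ i, CMat n →ₗ[ℂ] Matrix (β i) (β i) ℂ} (h : ∀ i, IsEquivariant (F i)) :
    IsEquivariant (blockSum F) := by
  intro U hU
  choose V hV hF using fun i => h i U hU
  refine ⟨Matrix.blockDiagonal' V, ?_, fun X => ?_⟩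
  · simp only [Matrix.mem_unitaryGroup_iff, Matrix.star_eq_conjTranspose] at hV ⊢
    rw [Matrix.blockDiagonal'_conjTranspose, ← Matrix.blockDiagonal'_mul]
    simp only [hV]
    exact Matrix.blockDiagonal'_one
  · rw [Matrix.blockDiagonal'_conjTranspose]
    simp only [blockSum, LinearMap.coe_mk, AddHom.coe_mk, hF, Matrix.blockDiagonal'_mul]

end blockSum

/-! ### Countable families and the main theorem -/

theorem continuous_pairing_left [Fintype ι] (X : Matrix ι ι ℂ) :
    Continuous fun W : Matrix ι ι ℂ => pairing W X :=
  continuous_finsetSum _ fun a _ => continuous_finsetSum _ fun b _ =>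
    (continuous_id.matrix_elem a b).mul continuous_const

/-- Countably many witnesses suffice to detect all states of Schmidt number larger than `t`. -/
theorem exists_seq_isRankPositive (t m n : ℕ) :
    ∃ W : ℕ → CMat₂ m n, (∀ j, IsRankPositive t (W j)) ∧
      ∀ ρ ∈ densityMatrices m n, ρ ∉ schmidtNumberLE t m n → ∃ j, ¬ 0 ≤ pairing (W j) ρ := by
  have : SecondCountableTopology (CMat₂ m n) :=
    inferInstanceAs (SecondCountableTopology (Fin m × Fin n → Fin m × Fin n → ℂ))
  let T : Set (CMat₂ m n) := {W | IsRankPositive t W}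
  have : Nonempty T := ⟨0, fun ψ _ => by simp [pairing]⟩
  refine ⟨fun j => TopologicalSpace.denseSeq T j, fun j => (TopologicalSpace.denseSeq T j).2,
    fun ρ hρ h => ?_⟩
  obtain ⟨W, hW, hneg⟩ := exists_isRankPositive_pairing_neg hρ h
  -- Detecting `ρ` is an open condition on the witness, so a member of a dense sequence of witnesses
  -- already does it.
  have ho : IsOpen {W : T | ¬ 0 ≤ pairing W.1 ρ} :=
    (isClosed_Ici.preimage ((continuous_pairing_left ρ).comp continuous_subtype_val)).isOpen_compl
  obtain ⟨j, hj⟩ := (TopologicalSpace.denseRange_denseSeq T).exists_mem_open ho ⟨⟨W, hW⟩, hneg⟩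
  exact ⟨j, hj⟩

/-- Countably many equivariant `t`-positive maps suffice to detect all states of Schmidt number
larger than `t`. -/
theorem exists_seq_isUnitarilyEquivariant (n t : ℕ) :
    ∃ (N : ℕ → ℕ) (F : ∀ i, CMat n →ₗ[ℂ] CMat (N i)),
      (∀ i, 1 ≤ N i ∧ IsUnitarilyEquivariant (F i) ∧ IsTPositive t (F i)) ∧
      ∀ m, 1 ≤ m → ∀ ρ ∈ densityMatrices m n, ρ ∉ schmidtNumberLE t m n →
        ∃ i, ¬ (ampliation m (F i) ρ).PosSemidef := by
  choose W hW hdet using fun m => exists_seq_isRankPositive t m n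
  -- Triples: dimension `m - 1`, index of the witness, tensor power `k`. The shift keeps every
  -- codomain nonzero.
  let e : ℕ ≃ ℕ × ℕ × ℕ := (Denumerable.eqv (ℕ × ℕ × ℕ)).symm
  let F (p : ℕ × ℕ × ℕ) := toFinMap (twirl p.2.2 (mapOfMatrix (W (p.1 + 1) p.2.1)))
  refine ⟨fun i => _, fun i => F (e i),
    fun i => ⟨Fintype.card_pos, (isEquivariant_twirl _ _).toFinMap, fun X hX => ?_⟩,
    fun m hm ρ hρ h => ?_⟩
  · exact (blockMap_toFinMap_posSemidef_iff _ _).mpr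
      (isBlockPositive_twirl (hW _ _).isBlockPositive _ X hX)
  · obtain ⟨m, rfl⟩ := Nat.exists_eq_add_of_le' hm
    obtain ⟨j, hj⟩ := hdet _ ρ hρ h
    by_contra! hc
    refine hj ?_
    rw [← dotProduct_blockMap_mapOfMatrix]
    refine dotProduct_blockMap_nonneg_of_twirl (fun k => ?_) _
    have hk : ∀ p, (ampliation (m + 1) (F p) ρ).PosSemidef := e.surjective.forall.mpr hc
    exact (blockMap_toFinMap_posSemidef_iff _ _).mp (hk (m, j, k))

theorem mainTheorem8 (n t : ℕ) (hn : 1 ≤ n) (ht : 1 ≤ t) :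
    ∃ (N : ℕ+ → ℕ) (Φ : (a : ℕ+) → (CMat n →ₗ[ℂ] CMat (N a))),
      (∀ a, 2 ≤ N a ∧ IsUnitarilyEquivariant (Φ a) ∧ IsTPositive t (Φ a)) ∧
      ∀ m : ℕ, 1 ≤ m →
        Antitone (fun a => undetectedStates m (Φ a)) ∧
        (⋂ a, undetectedStates m (Φ a)) = schmidtNumberLE t m n := by
  obtain ⟨N, F, hF, hdet⟩ := exists_seq_isUnitarilyEquivariant n t
  -- Each of the first `a` maps is taken twice: this does not change detection, and it secures `2 ≤
  -- N a` even when `a = 1` and the only block has size one.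
  let Φ (a : ℕ+) := toFinMap (blockSum fun i : Bool × Fin (a : ℕ) => F i.2)
  have hΦ : ∀ (a : ℕ+) (m : ℕ) (ρ : CMat₂ m n), (ampliation m (Φ a) ρ).PosSemidef ↔
      ∀ i < (a : ℕ), (ampliation m (F i) ρ).PosSemidef := by
    intro a m ρ
    rw [ampliation_eq_blockMap, blockMap_toFinMap_posSemidef_iff, blockMap_blockSum_posSemidef_iff]
    exact ⟨fun h i hi => h (true, ⟨i, hi⟩), fun h i => h i.2 i.2.2⟩
  have hpos : ∀ a, IsTPositive t (Φ a) := fun a X hX => (hΦ a t X).mpr fun i _ => (hF i).2.2 X hX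
  refine ⟨fun a => _, Φ, fun a => ⟨?_, (isEquivariant_blockSum fun i => (hF _).2.1).toFinMap,
    hpos a⟩, fun m hm => ⟨fun a b hab ρ hρ => ⟨hρ.1, ?_⟩, Set.Subset.antisymm (fun ρ hρ => ?_) ?_⟩⟩
  · change 2 ≤ Fintype.card _
    rw [Fintype.card_sigma]
    calc 2 ≤ ∑ _i : Bool × Fin (a : ℕ), 1 := by simp; exact a.2
      _ ≤ _ := Finset.sum_le_sum fun i _ => by simpa using (hF i.2).1
  · exact (hΦ a m ρ).mpr fun i hi => (hΦ b m ρ).mp hρ.2 i (hi.trans_le hab)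
  · rw [Set.mem_iInter] at hρ
    by_contra h
    obtain ⟨i, hi⟩ := hdet m hm ρ (hρ 1).1 h
    exact hi ((hΦ i.succPNat m ρ).mp (hρ i.succPNat).2 i (by simp))
  · exact Set.subset_iInter fun a => schmidtNumberLE_subset_undetectedStates (hpos a)
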